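/- Let $\mathbf{Met}$ be the category of extended metric spaces (metrics with values in $[0,\infty]$) and nonexpansive maps. For extended metric spaces $A,M$ let $M^A$ be the space of nonexpansive maps $A\to M$ with the supremum metric. A monad $T$ on $\mathbf{Met}$ is *enriched* if each map $\mathbf{Met}(X,Y)\to\mathbf{Met}(TX,TY)$, $f\mapsto T(f)$, is nonexpansive for the supremum metrics, and it is of *countable arity* if it preserves countably filtered ($\aleph_1$-filtered) colimits. A *metric signature* $\Omega$ is a set of operation symbols $f$, each with an arity, which is a countable extended metric space. *Preterms* are built from a fixed countably infinite set of variables by the rule: if $f$ has arity $A$ and $(t_i)_{i\in A}$ are preterms, then $f((t_i)_{i\in A})$ is a preterm. A *context* $\Gamma$ is a (possibly infinite) set of formal equalities $x=_\varepsilon y$ between variables, $\varepsilon\in[0,\infty)$. A *judgment* is $\Gamma\vdash t\ \mathrm{ok}$ or $\Gamma\vdash s=_\varepsilon t$ with preterms $s,t$ and $\varepsilon\in[0,\infty)$. For a set $S$ of judgments, $\vdash_S$ is the least set of judgments that contains $S$ and is closed under the following rules. * $\Gamma\vdash x\ \mathrm{ok}$ for every variable $x$; $\Gamma\vdash x=_\varepsilon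 y$ if $(x=_\varepsilon y)\in\Gamma$. * If $\Gamma\vdash t\ \mathrm{ok}$, then $\Gamma\vdash t=_0 t$. If $\Gamma\vdash s=_\varepsilon t$, then $\Gamma\vdash t=_\varepsilon s$, and $\Gamma\vdash s=_{\varepsilon'}t$ for all $\varepsilon'>\varepsilon$. If $\Gamma\vdash r=_\varepsilon s$ and $\Gamma\vdash s=_{\varepsilon'}t$, then $\Gamma\vdash r=_{\varepsilon+\varepsilon'}t$. If $\Gamma\vdash s=_{\varepsilon'}t$ for all $\varepsilon'>\varepsilon$, then $\Gamma\vdash s=_\varepsilon t$. * Let $f$ have arity $(A,d)$. If $\Gamma\vdash t_i\ \mathrm{ok}$ for all $i\in A$ and $\Gamma\vdash t_i=_{d(i,j)}t_j$ whenever $d(i,j)<\infty$, then $\Gamma\vdash f((t_i))\ \mathrm{ok}$. If $\Gamma\vdash s_i=_{d(i,j)}s_j$ and $\Gamma\vdash t_i=_{d(i,j)}t_j$ whenever $d(i,j)<\infty$, and $\Gamma\vdash s_i=_\varepsilon t_i$ for all $i\in A$, then $\Gamma\vdash f((s_i))=_\varepsilon f((t_i))$. * Let $\sigma$ be a substitution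 of preterms for variables. If $\Gamma\vdash\sigma(x)\ \mathrm{ok}$ for all variables $x$, $\Gamma\vdash\sigma(x)=_\delta\sigma(y)$ for all $(x=_\delta y)\in\Delta$, and $\Delta\vdash s=_\varepsilon t$, then $\Gamma\vdash s[\sigma]=_\varepsilon t[\sigma]$. A *metric equational theory* $\mathcal T$ over $\Omega$ is a set of judgments that contains $\Gamma\vdash s\ \mathrm{ok}$ and $\Gamma\vdash t\ \mathrm{ok}$ whenever it contains $\Gamma\vdash s=_\varepsilon t$, and that equals $\vdash_{\mathcal T^=}$, where $\mathcal T^=$ is the set of judgments of the form $\Gamma\vdash s=_\varepsilon t$ in $\mathcal T$. It is a *quantitative equational theory* if all arities of $\Omega$ are discrete (distinct points have distance $\infty$). A *model* of $\Omega$ is an extended metric space $M$ with a nonexpansive map $M[f]\colon M^A\to M$ for each symbol $f$ of arity $A$; a homomorphism is a nonexpansive map commuting with the operations. Under an assignment $\alpha$ of the variables to points of $M$, a preterm $f((t_i)_{i\in A})$ is defined if all $t_i$ are and their values form a nonexpansive family $A\to M$, and its value is then $M[f]$ of this family; a variable $x$ has value $\alpha(x)$. The model $M$ satisfies $\Gamma\vdash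 t\ \mathrm{ok}$ (resp. $\Gamma\vdash s=_\varepsilon t$) if for every assignment satisfying all $x=_\delta y$ in $\Gamma$ (that is, $d(\alpha(x),\alpha(y))\le\delta$) the preterm $t$ is defined (resp. $s,t$ are defined and their values have distance at most $\varepsilon$). $\mathrm{Mod}(\mathcal T)$ is the full subcategory of models of $\Omega$ that satisfy all judgments of $\mathcal T$. The theory $\mathcal T$ *axiomatizes* a monad $T$ on $\mathbf{Met}$ if $T$ is isomorphic, as a monad, to the free-model monad of $\mathcal T$, i.e. the monad induced by the forgetful functor $\mathrm{Mod}(\mathcal T)\to\mathbf{Met}$ and its left adjoint. **Theorem.** Let $T$ be an enriched monad of countable arity on $\mathbf{Met}$. Then $T$ is axiomatized by some quantitative equational theory if and only if $T$ preserves surjections, i.e. $T(f)\colon TX\to TY$ is surjective for every surjective nonexpansive map $f\colon X\to Y$. -/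

import Mathlib

open CategoryTheory
open scoped NNReal ENNReal

universe u v w

/-! ### Extended metric spaces and nonexpansive maps -/

/-- Nonexpansive maps between extended metric spaces. -/
structure NonexpMap (A : Type u) (B : Type v) [EMetricSpace A] [EMetricSpace B] where
  toFun : A → B
  nonexp' : ∀ x y, edist (toFun x) (toFun y) ≤ edist x y

namespace NonexpMap

section

variable {A : Type u} {B : Type v} {C : Type w} [EMetricSpace A] [EMetricSpace B] [EMetricSpace C]

instance : FunLike (NonexpMap A B) A B where
  coe := toFun
  coe_injective f g h := by cases f; cases g; congr

@[ext]
theorem ext {f g : NonexpMap A B} (h : ∀ x, f x = g x) : f = g := DFunLike.ext f g h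

theorem nonexp (f : NonexpMap A B) (x y : A) : edist (f x) (f y) ≤ edist x y := f.nonexp' x y

/-- The identity map. -/
def id (A : Type u) [EMetricSpace A] : NonexpMap A A := ⟨fun x => x, fun _ _ => le_rfl⟩

/-- Composition `g ∘ f`. -/
def comp (g : NonexpMap B C) (f : NonexpMap A B) : NonexpMap A C :=
  ⟨fun x => g (f x), fun x y => (g.nonexp _ _).trans (f.nonexp x y)⟩

@[simp] theorem mk_apply (f : A → B) (hf : ∀ x y, edist (f x) (f y) ≤ edist x y) (x : A) :
    (⟨f, hf⟩ : NonexpMap A B) x = f x := rfl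

@[simp] theorem id_apply (x : A) : NonexpMap.id A x = x := rfl

@[simp] theorem comp_apply (g : NonexpMap B C) (f : NonexpMap A B) (x : A) :
    g.comp f x = g (f x) := rfl

/-- The power `B ^ A`: nonexpansive maps with the supremum metric. -/
noncomputable instance : EMetricSpace (NonexpMap A B) where
  edist f g := ⨆ x, edist (f x) (g x)
  edist_self f := by simp
  edist_comm f g := by simp only [edist_comm]
  edist_triangle f g h := iSup_le fun x =>
    (edist_triangle _ (g x) _).trans
      (add_le_add (le_iSup (fun x => edist (f x) (g x)) x) (le_iSup (fun x => edist (g x) (h x)) x))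
  eq_of_edist_eq_zero {f g} h := by
    ext x
    have hx : edist (f x) (g x) ≤ 0 := (le_iSup (fun x => edist (f x) (g x)) x).trans_eq h
    exact edist_le_zero.mp hx

theorem edist_def (f g : NonexpMap A B) : edist f g = ⨆ x, edist (f x) (g x) := rfl

end

end NonexpMap

/-- The category `Met` of extended metric spaces and nonexpansive maps. -/
structure Met : Type (u + 1) where
  of ::
  carrier : Type u
  [str : EMetricSpace carrier]

attribute [instance] Met.str

namespace Met

instance : CoeSort Met.{u} (Type u) := ⟨carrier⟩

instance : LargeCategory.{u} Met.{u} where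
  Hom X Y := NonexpMap X Y
  id X := NonexpMap.id X
  comp f g := NonexpMap.comp g f

instance : ConcreteCategory Met.{u} (fun X Y => NonexpMap X Y) where
  hom f := f
  ofHom f := f

end Met

/-- An endofunctor of `Met` is enriched (strong) if it is nonexpansive on hom-spaces. -/
def IsMetEnriched (F : Met.{u} ⥤ Met.{u}) : Prop :=
  ∀ (X Y : Met.{u}) (f g : X ⟶ Y),
    edist (ConcreteCategory.hom (F.map f)) (ConcreteCategory.hom (F.map g)) ≤
      edist (ConcreteCategory.hom f) (ConcreteCategory.hom g)

/-- An endofunctor of `Met` has countable arity if it is `ℵ₁`-accessible, i.e. preserves (small)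
countably filtered colimits. -/
def HasCountableArity (F : Met.{u} ⥤ Met.{u}) : Prop :=
  haveI : Fact (Cardinal.aleph.{u} 1).IsRegular := ⟨Cardinal.isRegular_aleph_one⟩
  F.IsCardinalAccessible (Cardinal.aleph.{u} 1)

/-- `F` preserves surjections. -/
def PreservesSurjections (F : Met.{u} ⥤ Met.{u}) : Prop :=
  ∀ (X Y : Met.{u}) (f : X ⟶ Y),
    Function.Surjective (ConcreteCategory.hom f) →
      Function.Surjective (ConcreteCategory.hom (F.map f))

/-! ### Syntax -/

/-- A metric signature: operation symbols whose arities are countable extended metric spaces. -/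
structure MetricSignature where
  Op : Type u
  Arity : Op → Type
  [countableArity : ∀ f, Countable (Arity f)]
  [metricArity : ∀ f, EMetricSpace (Arity f)]

attribute [instance] MetricSignature.countableArity MetricSignature.metricArity

/-- All arities are discrete: distinct elements are at distance `∞`. -/
def MetricSignature.IsDiscrete (Ω : MetricSignature.{u}) : Prop :=
  ∀ (f : Ω.Op) (i j : Ω.Arity f), i ≠ j → edist i j = ⊤

/-- Preterms over the countably infinite set of variables `ℕ`. -/
inductive Preterm (Ω : MetricSignature.{u}) : Type u
  | var (x : ℕ) : Preterm Ω
  | app (f : Ω.Op) (t : Ω.Arity f → Preterm Ω) : Preterm Ω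

namespace Preterm

variable {Ω : MetricSignature.{u}}

/-- Simultaneous substitution of preterms for variables. -/
def subst (σ : ℕ → Preterm Ω) : Preterm Ω → Preterm Ω
  | var x => σ x
  | app f t => app f fun i => (t i).subst σ

end Preterm

/-- A quantitative equality `x =_ε y` between variables. -/
structure VarEq where
  lhs : ℕ
  rhs : ℕ
  bound : ℝ≥0

/-- A context: a (possibly infinite) collection of quantitative equalities between variables. -/
abbrev MetContext : Type := Set VarEq

/-- The atoms `t ok` and `s =_ε t`. -/
inductive MetAtom (Ω : MetricSignature.{u}) : Type u
  | ok (t : Preterm Ω) : MetAtom Ω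
  | eq (s t : Preterm Ω) (ε : ℝ≥0) : MetAtom Ω

/-- A judgment `Γ ⊢ φ`. -/
structure Judgment (Ω : MetricSignature.{u}) where
  ctx : MetContext
  atom : MetAtom Ω

open Preterm MetAtom in
/-- `Derivable S Γ φ`: the judgment `Γ ⊢ φ` belongs to the least deducibility relation containing
the set `S` of judgments. -/
inductive Derivable {Ω : MetricSignature.{u}} (S : Set (Judgment Ω)) :
    MetContext → MetAtom Ω → Prop
  | ax {Γ : MetContext} {φ : MetAtom Ω} (h : ⟨Γ, φ⟩ ∈ S) : Derivable S Γ φ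
  | var (Γ : MetContext) (x : ℕ) : Derivable S Γ (ok (var x))
  | assum {Γ : MetContext} {x y : ℕ} {ε : ℝ≥0} (h : ⟨x, y, ε⟩ ∈ Γ) :
      Derivable S Γ (eq (var x) (var y) ε)
  | refl {Γ : MetContext} {t : Preterm Ω} (h : Derivable S Γ (ok t)) : Derivable S Γ (eq t t 0)
  | symm {Γ : MetContext} {s t : Preterm Ω} {ε : ℝ≥0} (h : Derivable S Γ (eq s t ε)) :
      Derivable S Γ (eq t s ε)
  | triang {Γ : MetContext} {r s t : Preterm Ω} {ε ε' : ℝ≥0} (h : Derivable S Γ (eq r s ε))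
      (h' : Derivable S Γ (eq s t ε')) : Derivable S Γ (eq r t (ε + ε'))
  | max {Γ : MetContext} {s t : Preterm Ω} {ε ε' : ℝ≥0} (hε : ε' < ε)
      (h : Derivable S Γ (eq s t ε')) : Derivable S Γ (eq s t ε)
  | cont {Γ : MetContext} {s t : Preterm Ω} {ε : ℝ≥0}
      (h : ∀ ε' : ℝ≥0, ε < ε' → Derivable S Γ (eq s t ε')) : Derivable S Γ (eq s t ε)
  | nexp {Γ : MetContext} (f : Ω.Op) (s t : Ω.Arity f → Preterm Ω) (ε : ℝ≥0)
      (hs : ∀ (i j : Ω.Arity f) (δ : ℝ≥0), edist i j = δ → Derivable S Γ (eq (s i) (s j) δ))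
      (ht : ∀ (i j : Ω.Arity f) (δ : ℝ≥0), edist i j = δ → Derivable S Γ (eq (t i) (t j) δ))
      (hst : ∀ i, Derivable S Γ (eq (s i) (t i) ε)) :
      Derivable S Γ (eq (app f s) (app f t) ε)
  | subst {Γ Δ : MetContext} {s t : Preterm Ω} {ε : ℝ≥0} (σ : ℕ → Preterm Ω)
      (hok : ∀ x, Derivable S Γ (ok (σ x)))
      (hσ : ∀ e ∈ Δ, Derivable S Γ (eq (σ e.lhs) (σ e.rhs) e.bound))
      (h : Derivable S Δ (eq s t ε)) :
      Derivable S Γ (eq (s.subst σ) (t.subst σ) ε)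
  | app {Γ : MetContext} (f : Ω.Op) (t : Ω.Arity f → Preterm Ω)
      (hok : ∀ i, Derivable S Γ (ok (t i)))
      (h : ∀ (i j : Ω.Arity f) (δ : ℝ≥0), edist i j = δ → Derivable S Γ (eq (t i) (t j) δ)) :
      Derivable S Γ (ok (app f t))

/-- The equational judgments in a collection of judgments. -/
def equationalPart {Ω : MetricSignature.{u}} (S : Set (Judgment Ω)) : Set (Judgment Ω) :=
  {j | j ∈ S ∧ ∃ s t ε, j.atom = MetAtom.eq s t ε}

/-- A metric equational theory over `Ω`: a well-formed collection of judgments which is the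
deducibility relation generated by its equational judgments. -/
structure MetricTheory (Ω : MetricSignature.{u}) where
  judgments : Set (Judgment Ω)
  wellFormed : ∀ (Γ : MetContext) (s t : Preterm Ω) (ε : ℝ≥0), ⟨Γ, .eq s t ε⟩ ∈ judgments →
    ⟨Γ, .ok s⟩ ∈ judgments ∧ ⟨Γ, .ok t⟩ ∈ judgments
  generated : ∀ (Γ : MetContext) (φ : MetAtom Ω),
    ⟨Γ, φ⟩ ∈ judgments ↔ Derivable (equationalPart judgments) Γ φ

/-! ### Models -/

/-- A model of the signature `Ω`: an extended metric space `M` with a nonexpansive map `M ^ A → M`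
for every operation symbol of arity `A`. -/
structure SigModel (Ω : MetricSignature.{u}) where
  space : Met.{u}
  op : ∀ f : Ω.Op, NonexpMap (NonexpMap (Ω.Arity f) space) space

namespace SigModel

variable {Ω : MetricSignature.{u}}

/-- Homomorphisms: nonexpansive maps commuting with all operations. -/
@[ext]
structure Hom (M N : SigModel Ω) where
  map : M.space ⟶ N.space
  map_op : ∀ (f : Ω.Op) (a : NonexpMap (Ω.Arity f) M.space),
    ConcreteCategory.hom map (M.op f a) = N.op f ((ConcreteCategory.hom map).comp a)

/-- The category `Mod(Ω)`. -/
instance : LargeCategory.{u} (SigModel.{u} Ω) where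
  Hom := Hom
  id M := ⟨𝟙 M.space, fun _ _ => rfl⟩
  comp φ ψ := ⟨φ.map ≫ ψ.map, fun f a =>
    (congrArg (ConcreteCategory.hom ψ.map) (φ.map_op f a)).trans (ψ.map_op f _)⟩

/-- The underlying metric space of a model of `Ω`. -/
def forget (Ω : MetricSignature.{u}) : SigModel Ω ⥤ Met.{u} where
  obj M := M.space
  map φ := φ.map

/-- `M.Eval α t m`: under the assignment `α` the preterm `t` is defined in `M` with value `m`. An
application `f(tᵢ)` is defined if all `tᵢ` are, and their values form a point of `M ^ A`, where `A`
is the arity of `f`. -/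
inductive Eval (M : SigModel Ω) (α : ℕ → M.space) : Preterm Ω → M.space → Prop
  | var (x : ℕ) : Eval M α (.var x) (α x)
  | app (f : Ω.Op) (t : Ω.Arity f → Preterm Ω) (a : NonexpMap (Ω.Arity f) M.space)
      (h : ∀ i, Eval M α (t i) (a i)) : Eval M α (.app f t) (M.op f a)

/-- The assignment `α` satisfies the context `Γ`. -/
def SatCtx (M : SigModel Ω) (α : ℕ → M.space) (Γ : MetContext) : Prop :=
  ∀ e ∈ Γ, edist (α e.lhs) (α e.rhs) ≤ e.bound

/-- `M.Sat Γ φ`: the model `M` satisfies the judgment `Γ ⊢ φ`. The bound on the supremum distance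
between the interpretations of terms is spelled out pointwise. -/
def Sat (M : SigModel Ω) (Γ : MetContext) : MetAtom Ω → Prop
  | .ok t => ∀ α, M.SatCtx α Γ → ∃ m, M.Eval α t m
  | .eq s t ε => ∀ α, M.SatCtx α Γ → ∃ m n, M.Eval α s m ∧ M.Eval α t n ∧ edist m n ≤ ε

end SigModel

namespace MetricTheory

variable {Ω : MetricSignature.{u}}

/-- The models of the signature satisfying every judgment of the theory. -/
def isModel (𝒯 : MetricTheory Ω) : ObjectProperty (SigModel Ω) :=
  fun M => ∀ j ∈ 𝒯.judgments, M.Sat j.ctx j.atom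

/-- The category `Mod(𝒯)` of models of a theory, a full subcategory of `Mod(Ω)`. -/
abbrev Mod (𝒯 : MetricTheory Ω) := 𝒯.isModel.FullSubcategory

/-- The forgetful functor `Mod(𝒯) ⥤ Met`. -/
def forget (𝒯 : MetricTheory Ω) : 𝒯.Mod ⥤ Met.{u} := 𝒯.isModel.ι ⋙ SigModel.forget Ω

/-- `𝒯` axiomatizes the monad `T`: the forgetful functor `Mod(𝒯) ⥤ Met` has a left adjoint (the free
model functor) and the monad of this adjunction is isomorphic to `T`. -/
def Axiomatizes (𝒯 : MetricTheory Ω) (T : Monad Met.{u}) : Prop :=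
  ∃ (F : Met.{u} ⥤ 𝒯.Mod) (adj : F ⊣ 𝒯.forget), Nonempty (adj.toMonad ≅ T)

end MetricTheory

/-- `T` is axiomatizable by a quantitative equational theory, i.e. by a metric equational theory
all of whose operations have discrete arity. -/
def IsQETAxiomatizable (T : Monad Met.{u}) : Prop :=
  ∃ Ω : MetricSignature.{u}, Ω.IsDiscrete ∧ ∃ 𝒯 : MetricTheory Ω, 𝒯.Axiomatizes T

/-!
Forward direction: in the free model on `X`, the elements in the image of the unit generate, because
the inclusion of a submodel containing them splits. When the arities are discrete, the range of a
homomorphism is closed under the operations, since a choice of preimages of a family is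
automatically nonexpansive. If `f : X ⟶ Y` is surjective, the range of `T f` thus contains the image
of the unit of `Y`, hence everything.

Converse: take the elements of `T S`, for discrete countable spaces `S`, as the operations of arity
`S`, and as theory all judgments valid in every `T`-algebra. Enrichment makes `T`-algebras models.
For countable `X`, choose a surjection `p : S → X` from a discrete space. As `T p` is surjective,
every element of `T X` is denoted by a preterm over the points of `X`. The assignments that satisfy
the context of all finite distances in `X` are the nonexpansive maps out of `X`, so a distance bound
in `T X` is a judgment of the theory; sending an element to the value of a preterm denoting it
therefore extends any `X ⟶ M`, for a model `M` of the theory, to a homomorphism `T X ⟶ M`. For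
arbitrary `X`, these extensions glue along the colimit of the countable subspaces, which `T`
preserves. So `T X` is the free model on `X`.
-/

open Limits

namespace NonexpMap

variable {A : Type v} {B : Type w} [EMetricSpace A] [EMetricSpace B]

theorem edist_le_iff {f g : NonexpMap A B} {c : ℝ≥0∞} :
    edist f g ≤ c ↔ ∀ x, edist (f x) (g x) ≤ c := by
  rw [edist_def, iSup_le_iff]

theorem edist_apply_le (f g : NonexpMap A B) (x : A) : edist (f x) (g x) ≤ edist f g :=
  edist_le_iff.1 le_rfl x

/-- A function out of a discrete extended metric space, as a nonexpansive map. -/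
def ofDiscrete (h : ∀ i j : A, i ≠ j → edist i j = ⊤) (g : A → B) : NonexpMap A B where
  toFun := g
  nonexp' i j := by
    rcases eq_or_ne i j with rfl | hij
    · rw [edist_self, edist_self]
    · exact le_top.trans_eq (h i j hij).symm

end NonexpMap

namespace Met

/-- The inclusion of a subspace. -/
def incl {X : Met.{u}} (S : Set X) : Met.of S ⟶ X :=
  ConcreteCategory.ofHom ⟨Subtype.val, fun _ _ => le_rfl⟩

end Met

namespace SigModel

variable {Ω : MetricSignature.{u}} {M N : SigModel Ω}

theorem Eval.unique {α : ℕ → M.space} {t : Preterm Ω} {m n : M.space} (hm : M.Eval α t m)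
    (hn : M.Eval α t n) : m = n := by
  induction hm generalizing n with
  | var x => cases hn; rfl
  | app f t a _ ih =>
    cases hn with
    | app _ _ b hb => exact congrArg (M.op f) (NonexpMap.ext fun i => ih i (hb i))

theorem Eval.subst {α β : ℕ → M.space} {σ : ℕ → Preterm Ω} (hσ : ∀ x, M.Eval α (σ x) (β x))
    {t : Preterm Ω} {m : M.space} (h : M.Eval β t m) : M.Eval α (t.subst σ) m := by
  induction h with
  | var x => exact hσ x
  | app f t a _ ih => exact .app f _ a ih

theorem Eval.exists_of_isometry {φ : M ⟶ N} (hφ : Isometry φ.map) {α : ℕ → M.space}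
    {t : Preterm Ω} {n : N.space} (h : N.Eval (fun x => φ.map (α x)) t n) :
    ∃ m, M.Eval α t m ∧ φ.map m = n := by
  induction h with
  | var x => exact ⟨α x, .var x, rfl⟩
  | app f t b _ ih =>
    choose a ha hab using ih
    let a' : NonexpMap (Ω.Arity f) M.space :=
      ⟨a, fun i j => by rw [← hφ.edist_eq, hab, hab]; exact b.nonexp i j⟩
    exact ⟨M.op f a', .app f t a' ha,
      (φ.map_op f a').trans (congrArg (N.op f) (NonexpMap.ext hab))⟩

theorem Sat.of_isometry {φ : M ⟶ N} (hφ : Isometry φ.map) {Γ : MetContext} {ψ : MetAtom Ω}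
    (hN : N.Sat Γ ψ) : M.Sat Γ ψ := by
  have hctx {α : ℕ → M.space} (hα : M.SatCtx α Γ) : N.SatCtx (fun x => φ.map (α x)) Γ :=
    fun e he => (hφ.edist_eq _ _).trans_le (hα e he)
  cases ψ with
  | ok t =>
    intro α hα
    obtain ⟨n, hn⟩ := hN _ (hctx hα)
    obtain ⟨m, hm, -⟩ := hn.exists_of_isometry hφ
    exact ⟨m, hm⟩
  | eq s t ε =>
    intro α hα
    obtain ⟨_, _, hs, ht, hst⟩ := hN _ (hctx hα)
    obtain ⟨m, hm, rfl⟩ := hs.exists_of_isometry hφ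
    obtain ⟨n, hn, rfl⟩ := ht.exists_of_isometry hφ
    exact ⟨m, n, hm, hn, (hφ.edist_eq m n).symm.trans_le hst⟩

/-- A set of points of a model that is closed under all operations; only families that are
nonexpansive in the ambient metric are considered. -/
def IsClosedUnderOps (M : SigModel Ω) (S : Set M.space) : Prop :=
  ∀ (f : Ω.Op) (a : NonexpMap (Ω.Arity f) M.space), (∀ i, a i ∈ S) → M.op f a ∈ S

/-- The submodel carried by a set of points that is closed under all operations. -/
noncomputable def submodel (M : SigModel Ω) {S : Set M.space} (hS : M.IsClosedUnderOps S) :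
    SigModel Ω where
  space := Met.of S
  op f :=
    { toFun a := ⟨M.op f ((ConcreteCategory.hom (Met.incl S)).comp a), hS f _ fun i => (a i).2⟩
      nonexp' a b := (NonexpMap.nonexp _ _ _).trans
        (NonexpMap.edist_le_iff.2 fun i => NonexpMap.edist_apply_le a b i) }

/-- The inclusion homomorphism of a submodel. -/
noncomputable def submodelι (M : SigModel Ω) {S : Set M.space} (hS : M.IsClosedUnderOps S) :
    M.submodel hS ⟶ M where
  map := Met.incl S
  map_op _ _ := rfl

theorem isClosedUnderOps_range (hΩ : Ω.IsDiscrete) (φ : M ⟶ N) :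
    N.IsClosedUnderOps (Set.range φ.map) := by
  intro f a ha
  choose b hb using ha
  exact ⟨M.op f (.ofDiscrete (hΩ f) b),
    (φ.map_op f _).trans (congrArg (N.op f) (NonexpMap.ext hb))⟩

theorem edist_le_edist_of_sat {A : Type v} [EMetricSpace A] {Γ : MetContext} {α : ℕ → M.space}
    (hα : M.SatCtx α Γ) {t : A → Preterm Ω} {m : A → M.space}
    (ht : ∀ (i j : A) (δ : ℝ≥0), edist i j = δ → M.Sat Γ (.eq (t i) (t j) δ))
    (hm : ∀ i, M.Eval α (t i) (m i)) (i j : A) : edist (m i) (m j) ≤ edist i j := by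
  rcases eq_or_ne (edist i j) ⊤ with hij | hij
  · exact le_top.trans_eq hij.symm
  · obtain ⟨k, l, hk, hl, hkl⟩ := ht i j _ (ENNReal.coe_toNNReal hij).symm α hα
    rwa [(hm i).unique hk, (hm j).unique hl, ← ENNReal.coe_toNNReal hij]

namespace Sat

variable {Γ Δ : MetContext} {r s t : Preterm Ω} {ε ε' : ℝ≥0}

theorem trans (h : M.Sat Γ (.eq r s ε)) (h' : M.Sat Γ (.eq s t ε')) :
    M.Sat Γ (.eq r t (ε + ε')) := by
  intro α hα
  obtain ⟨m, n, hm, hn, hmn⟩ := h α hα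
  obtain ⟨n', k, hn', hk, hnk⟩ := h' α hα
  obtain rfl := hn.unique hn'
  refine ⟨m, k, hm, hk, (edist_triangle m n k).trans ?_⟩
  rw [ENNReal.coe_add]
  exact add_le_add hmn hnk

theorem of_forall_lt (h : ∀ ε' : ℝ≥0, ε < ε' → M.Sat Γ (.eq s t ε')) : M.Sat Γ (.eq s t ε) := by
  intro α hα
  obtain ⟨m, n, hm, hn, -⟩ := h (ε + 1) (lt_add_of_pos_right ε one_pos) α hα
  refine ⟨m, n, hm, hn, ENNReal.le_of_forall_pos_le_add fun δ hδ _ => ?_⟩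
  obtain ⟨m', n', hm', hn', hmn⟩ := h (ε + δ) (lt_add_of_pos_right ε hδ) α hα
  rwa [hm.unique hm', hn.unique hn', ← ENNReal.coe_add]

theorem ok_app {f : Ω.Op} {t : Ω.Arity f → Preterm Ω} (hok : ∀ i, M.Sat Γ (.ok (t i)))
    (ht : ∀ (i j : Ω.Arity f) (δ : ℝ≥0), edist i j = δ → M.Sat Γ (.eq (t i) (t j) δ)) :
    M.Sat Γ (.ok (.app f t)) := by
  intro α hα
  choose m hm using fun i => hok i α hα
  exact ⟨_, .app f t ⟨m, edist_le_edist_of_sat hα ht hm⟩ hm⟩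

theorem eq_app {f : Ω.Op} {s t : Ω.Arity f → Preterm Ω}
    (hs : ∀ (i j : Ω.Arity f) (δ : ℝ≥0), edist i j = δ → M.Sat Γ (.eq (s i) (s j) δ))
    (ht : ∀ (i j : Ω.Arity f) (δ : ℝ≥0), edist i j = δ → M.Sat Γ (.eq (t i) (t j) δ))
    (hst : ∀ i, M.Sat Γ (.eq (s i) (t i) ε)) : M.Sat Γ (.eq (.app f s) (.app f t) ε) := by
  intro α hα
  choose m n hm hn hmn using fun i => hst i α hα
  exact ⟨_, _, .app f s ⟨m, edist_le_edist_of_sat hα hs hm⟩ hm,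
    .app f t ⟨n, edist_le_edist_of_sat hα ht hn⟩ hn,
    ((M.op f).nonexp _ _).trans (NonexpMap.edist_le_iff.2 hmn)⟩

theorem subst {σ : ℕ → Preterm Ω} (hok : ∀ x, M.Sat Γ (.ok (σ x)))
    (hσ : ∀ e ∈ Δ, M.Sat Γ (.eq (σ e.lhs) (σ e.rhs) e.bound)) (h : M.Sat Δ (.eq s t ε)) :
    M.Sat Γ (.eq (s.subst σ) (t.subst σ) ε) := by
  intro α hα
  choose β hβ using fun x => hok x α hα
  have hβΔ : M.SatCtx β Δ := fun e he => by
    obtain ⟨k, l, hk, hl, hkl⟩ := hσ e he α hα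
    rwa [(hβ _).unique hk, (hβ _).unique hl]
  obtain ⟨m, n, hm, hn, hmn⟩ := h β hβΔ
  exact ⟨m, n, hm.subst hβ, hn.subst hβ, hmn⟩

theorem of_derivable {S : Set (Judgment Ω)} (hS : ∀ j ∈ S, M.Sat j.ctx j.atom) {φ : MetAtom Ω}
    (h : Derivable S Γ φ) : M.Sat Γ φ := by
  induction h with
  | ax h => exact hS _ h
  | var Γ x => exact fun α _ => ⟨α x, .var x⟩
  | assum h => exact fun α hα => ⟨_, _, .var _, .var _, hα _ h⟩
  | refl _ ih =>
    intro α hα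
    obtain ⟨m, hm⟩ := ih α hα
    exact ⟨m, m, hm, hm, (edist_self m).trans_le zero_le⟩
  | symm _ ih =>
    intro α hα
    obtain ⟨m, n, hm, hn, hmn⟩ := ih α hα
    exact ⟨n, m, hn, hm, (edist_comm n m).trans_le hmn⟩
  | triang _ _ ih ih' => exact ih.trans ih'
  | max hε _ ih =>
    intro α hα
    obtain ⟨m, n, hm, hn, hmn⟩ := ih α hα
    exact ⟨m, n, hm, hn, hmn.trans (ENNReal.coe_le_coe.2 hε.le)⟩
  | cont _ ih => exact of_forall_lt ih
  | nexp f s t ε _ _ _ hs ht hst => exact eq_app hs ht hst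
  | subst σ _ _ _ hok hσ h => exact h.subst hok hσ
  | app f t _ _ hok ht => exact ok_app hok ht

end Sat

end SigModel

namespace MetricTheory

variable {Ω : MetricSignature.{u}}

theorem mem_of_forall_unit_mem (𝒯 : MetricTheory Ω) {F : Met.{u} ⥤ 𝒯.Mod} (adj : F ⊣ 𝒯.forget)
    (X : Met.{u}) {S : Set (F.obj X).obj.space} (hS : (F.obj X).obj.IsClosedUnderOps S)
    (hη : ∀ x, adj.unit.app X x ∈ S) (z : (F.obj X).obj.space) : z ∈ S := by
  let N : 𝒯.Mod := ⟨(F.obj X).obj.submodel hS, fun j hj => SigModel.Sat.of_isometry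
    (φ := SigModel.submodelι _ hS) isometry_subtype_coe ((F.obj X).property j hj)⟩
  let ι : N ⟶ F.obj X := ObjectProperty.homMk (SigModel.submodelι _ hS)
  let g : X ⟶ 𝒯.forget.obj N :=
    ConcreteCategory.ofHom ⟨fun x => ⟨_, hη x⟩, (adj.unit.app X).nonexp⟩
  have retract : (adj.homEquiv X N).symm g ≫ ι = 𝟙 _ := by
    apply (adj.homEquiv X _).injective
    rw [adj.homEquiv_naturality_right, Equiv.apply_symm_apply, adj.homEquiv_id]
    rfl
  have hz := ConcreteCategory.congr_hom (congrArg 𝒯.forget.map retract) z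
  exact Set.mem_of_eq_of_mem hz.symm (𝒯.forget.map ((adj.homEquiv X N).symm g) z).2

theorem preservesSurjections_of_adjunction (𝒯 : MetricTheory Ω) (hΩ : Ω.IsDiscrete)
    {F : Met.{u} ⥤ 𝒯.Mod} (adj : F ⊣ 𝒯.forget) : PreservesSurjections (F ⋙ 𝒯.forget) := by
  intro X Y f hf
  have hrange := SigModel.isClosedUnderOps_range hΩ (F.map f).hom
  refine 𝒯.mem_of_forall_unit_mem adj Y hrange fun y => ?_
  obtain ⟨x, rfl⟩ := hf y
  exact ⟨adj.unit.app X x, (ConcreteCategory.congr_hom (adj.unit.naturality f) x).symm⟩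

end MetricTheory

theorem PreservesSurjections.of_iso {F G : Met.{u} ⥤ Met.{u}} (e : F ≅ G)
    (hF : PreservesSurjections F) : PreservesSurjections G := by
  intro X Y f hf y
  obtain ⟨x, hx⟩ := hF X Y f hf (e.inv.app Y y)
  refine ⟨e.hom.app X x, ?_⟩
  calc G.map f (e.hom.app X x) = e.hom.app Y (F.map f x) :=
        (ConcreteCategory.congr_hom (e.hom.naturality f) x).symm
    _ = e.hom.app Y (e.inv.app Y y) := congrArg _ hx
    _ = y := ConcreteCategory.congr_hom (e.inv_hom_id_app Y) y

theorem IsQETAxiomatizable.preservesSurjections {T : Monad Met.{u}} (h : IsQETAxiomatizable T) :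
    PreservesSurjections T.toFunctor := by
  obtain ⟨Ω, hΩ, 𝒯, F, adj, ⟨e⟩⟩ := h
  exact (𝒯.preservesSurjections_of_adjunction hΩ adj).of_iso (MonadIso.toNatIso e)

/-! ### Theories of families of models over discrete signatures -/

theorem Derivable.ok_of_isDiscrete {Ω : MetricSignature.{u}} (hΩ : Ω.IsDiscrete)
    (S : Set (Judgment Ω)) (Γ : MetContext) (t : Preterm Ω) : Derivable S Γ (.ok t) := by
  induction t with
  | var x => exact .var Γ x
  | app f t ih =>
    refine .app f t ih fun i j δ hδ => ?_
    rcases eq_or_ne i j with rfl | hij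
    · obtain rfl : δ = 0 := by simpa only [edist_self, eq_comm, ENNReal.coe_eq_zero] using hδ
      exact .refl (ih i)
    · exact absurd ((hΩ f i j hij).symm.trans hδ) ENNReal.top_ne_coe

namespace MetricTheory

variable {Ω : MetricSignature.{u}}

/-- The theory of a family of models over a discrete signature: all judgments satisfied by every
member of the family. -/
def ofModels (hΩ : Ω.IsDiscrete) {ι : Type v} (M : ι → SigModel Ω) : MetricTheory Ω where
  judgments := {j | ∀ i, (M i).Sat j.ctx j.atom}
  wellFormed _ _ _ _ h :=
    ⟨fun i α hα => (h i α hα).elim fun m hm => ⟨m, hm.choose_spec.1⟩,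
      fun i α hα => (h i α hα).elim fun _ hm => ⟨hm.choose, hm.choose_spec.2.1⟩⟩
  generated Γ φ := by
    refine ⟨fun h => ?_, fun h i => .of_derivable (fun j hj => hj.1 i) h⟩
    cases φ with
    | ok t => exact .ok_of_isDiscrete hΩ _ Γ t
    | eq s t ε => exact .ax ⟨h, s, t, ε, rfl⟩

theorem isModel_ofModels (hΩ : Ω.IsDiscrete) {ι : Type v} (M : ι → SigModel Ω) (i : ι) :
    (ofModels hΩ M).isModel (M i) := fun _ hj => hj i

end MetricTheory

namespace SigModel

variable {Ω : MetricSignature.{u}}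

/-- `M.EvalOn v a t m`: under every assignment giving each variable `v i` the value `a i`, the
preterm `t` is defined in `M` with value `m`. -/
def EvalOn (M : SigModel Ω) {I : Type w} (v : I → ℕ) (a : I → M.space) (t : Preterm Ω)
    (m : M.space) : Prop :=
  ∀ α : ℕ → M.space, (∀ i, α (v i) = a i) → M.Eval α t m

variable {M : SigModel Ω} {I : Type w} {v : I → ℕ} {a : I → M.space}

theorem EvalOn.var (i : I) : M.EvalOn v a (.var (v i)) (a i) :=
  fun _ hα => hα i ▸ .var _

theorem EvalOn.app {f : Ω.Op} {t : Ω.Arity f → Preterm Ω} {b : NonexpMap (Ω.Arity f) M.space}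
    (h : ∀ i, M.EvalOn v a (t i) (b i)) : M.EvalOn v a (.app f t) (M.op f b) :=
  fun α hα => .app f t b fun i => h i α hα

end SigModel

/-- The context stating all finite distances between the points `p i`, each of them named by the
variable `v i`. -/
def MetContext.ofPoints {X : Type v} [EMetricSpace X] {I : Type w} (v : I → ℕ) (p : I → X) :
    MetContext :=
  {e | ∃ i j, e.lhs = v i ∧ e.rhs = v j ∧ edist (p i) (p j) ≤ e.bound}

namespace SigModel

variable {Ω : MetricSignature.{u}} {M : SigModel Ω} {X : Type v} [EMetricSpace X] {I : Type w}
  {v : I → ℕ} {p : I → X} {α : ℕ → M.space}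

theorem satCtx_ofPoints_iff : M.SatCtx α (.ofPoints v p) ↔
    ∀ i j, edist (α (v i)) (α (v j)) ≤ edist (p i) (p j) := by
  refine ⟨fun h i j => ?_, ?_⟩
  · rcases eq_or_ne (edist (p i) (p j)) ⊤ with hij | hij
    · exact le_top.trans_eq hij.symm
    · rw [← ENNReal.coe_toNNReal hij]
      exact h ⟨v i, v j, _⟩ ⟨i, j, rfl, rfl, (ENNReal.coe_toNNReal hij).ge⟩
  · rintro h ⟨_, _, ε⟩ ⟨i, j, rfl, rfl, hij⟩
    exact (h i j).trans hij

theorem satCtx_ofPoints_iff_exists_nonexpMap (hp : Function.Surjective p) :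
    M.SatCtx α (.ofPoints v p) ↔ ∃ q : NonexpMap X M.space, ∀ i, α (v i) = q (p i) := by
  rw [satCtx_ofPoints_iff]
  refine ⟨fun h => ?_, fun ⟨q, hq⟩ i j => ?_⟩
  · obtain ⟨r, hr⟩ := hp.hasRightInverse
    refine ⟨⟨fun x => α (v (r x)), fun x y => ?_⟩, fun i => edist_le_zero.1 ?_⟩
    · simpa only [hr x, hr y] using h (r x) (r y)
    · simpa only [NonexpMap.mk_apply, hr (p i), edist_self] using h i (r (p i))
  · rw [hq, hq]
    exact q.nonexp _ _

end SigModel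

/-! ### Countable subspaces -/

namespace Met

variable {X : Met.{u}}

/-- The poset of countable subsets of a space. -/
abbrev CountableSubsets (X : Met.{u}) : Type u := {B : Set X // B.Countable}

namespace CountableSubsets

theorem exists_forall_le {K : Type w} [Countable K] (B : K → CountableSubsets X) :
    ∃ C : CountableSubsets X, ∀ k, B k ≤ C :=
  ⟨⟨⋃ k, (B k).1, Set.countable_iUnion fun k => (B k).2⟩,
    fun k => Set.subset_iUnion (fun k => (B k).1) k⟩

theorem isCardinalFiltered (X : Met.{u}) [Fact (Cardinal.aleph.{u} 1).IsRegular] :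
    IsCardinalFiltered (CountableSubsets X) (Cardinal.aleph.{u} 1) :=
  isCardinalFiltered_preorder _ _ fun K B hK => by
    have : Countable K := by
      rwa [← Cardinal.mk_le_aleph0_iff, ← Order.lt_succ_iff, Cardinal.succ_aleph0]
    exact exists_forall_le B

/-- The diagram of countable subspaces of a space. -/
abbrev diagram (X : Met.{u}) : CountableSubsets X ⥤ Met.{u} where
  obj B := Met.of B.1
  map h := ConcreteCategory.ofHom ⟨Set.inclusion (leOfHom h), fun _ _ => le_rfl⟩

/-- A space as a cocone on its countable subspaces. -/
abbrev cocone (X : Met.{u}) : Cocone (diagram X) where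
  pt := X
  ι := { app B := incl B.1 }

theorem cocone_app_singleton (s : Cocone (diagram X)) {B : CountableSubsets X} (x : B.1) :
    s.ι.app ⟨{x.1}, Set.countable_singleton x.1⟩ ⟨x, rfl⟩ = s.ι.app B x := by
  have hxB : (⟨{x.1}, Set.countable_singleton x.1⟩ : CountableSubsets X) ≤ B :=
    Set.singleton_subset_iff.2 x.2
  exact (ConcreteCategory.congr_hom (s.w (homOfLE hxB)) ⟨x, rfl⟩).symm

/-- Every space is the colimit of its countable subspaces. -/
def isColimitCocone (X : Met.{u}) : IsColimit (cocone X) where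
  desc s := ConcreteCategory.ofHom
    { toFun x := s.ι.app ⟨{x}, Set.countable_singleton x⟩ ⟨x, rfl⟩
      nonexp' x y := by
        let xy : CountableSubsets X := ⟨{x, y}, (Set.countable_singleton y).insert x⟩
        let x' : xy.1 := ⟨x, Or.inl rfl⟩
        let y' : xy.1 := ⟨y, Or.inr rfl⟩
        rw [cocone_app_singleton s x', cocone_app_singleton s y']
        exact (s.ι.app xy).nonexp x' y' }
  fac s B := ConcreteCategory.hom_ext _ _ (cocone_app_singleton s)
  uniq s m hm := ConcreteCategory.hom_ext _ _ fun x =>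
    ConcreteCategory.congr_hom (hm ⟨{x}, Set.countable_singleton x⟩) ⟨x, rfl⟩

end CountableSubsets

theorem exists_of_isColimit {J : Type v} [Category.{w} J] {D : J ⥤ Met.{u}} {c : Cocone D}
    (hc : IsColimit c) (z : c.pt) : ∃ (j : J) (x : D.obj j), c.ι.app j x = z := by
  let S : Set c.pt := {z | ∃ (j : J) (x : D.obj j), c.ι.app j x = z}
  let image : Cocone D :=
    { pt := Met.of S
      ι :=
        { app j := ConcreteCategory.ofHom
            ⟨fun x => ⟨c.ι.app j x, j, x, rfl⟩, (c.ι.app j).nonexp⟩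
          naturality j k f := ConcreteCategory.hom_ext _ _ fun x =>
            Subtype.ext (ConcreteCategory.congr_hom (c.w f) x) } }
  have retract : hc.desc image ≫ incl S = 𝟙 _ := hc.hom_ext fun j => by
    rw [← Category.assoc, hc.fac, Category.comp_id]
    rfl
  have hz : incl S (hc.desc image z) = z := ConcreteCategory.congr_hom retract z
  exact (Set.mem_of_eq_of_mem hz.symm (hc.desc image z).2 : z ∈ S)

end Met

namespace HasCountableArity

open Met

variable {F : Met.{u} ⥤ Met.{u}}

theorem nonempty_isColimit_mapCocone (hF : HasCountableArity F) (X : Met.{u}) :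
    Nonempty (IsColimit (F.mapCocone (CountableSubsets.cocone X))) := by
  have : Fact (Cardinal.aleph.{u} 1).IsRegular := ⟨Cardinal.isRegular_aleph_one⟩
  have : F.IsCardinalAccessible (Cardinal.aleph.{u} 1) := hF
  have := CountableSubsets.isCardinalFiltered X
  have := F.preservesColimitsOfShape_of_isCardinalAccessible (Cardinal.aleph.{u} 1)
    (CountableSubsets X)
  exact ⟨isColimitOfPreserves F (CountableSubsets.isColimitCocone X)⟩

theorem exists_countable_lift (hF : HasCountableArity F) {X : Met.{u}} {K : Type w} [Countable K]
    (a : K → F.obj X) : ∃ (B : CountableSubsets X) (b : K → F.obj (Met.of B.1)),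
      ∀ k, F.map (incl B.1) (b k) = a k := by
  obtain ⟨hc⟩ := hF.nonempty_isColimit_mapCocone X
  choose A x hx using fun k => exists_of_isColimit hc (a k)
  obtain ⟨B, hB⟩ := CountableSubsets.exists_forall_le A
  refine ⟨B, fun k => F.map ((CountableSubsets.diagram X).map (homOfLE (hB k))) (x k), fun k => ?_⟩
  exact (ConcreteCategory.congr_hom
    ((F.mapCocone (CountableSubsets.cocone X)).w (homOfLE (hB k))) (x k)).trans (hx k)

end HasCountableArity

/-! ### Monads of adjunctions -/

section AdjunctionMonads

universe v₁ v₂ v₃ u₁ u₂ u₃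

variable {C : Type u₁} [Category.{v₁} C] {D : Type u₂} [Category.{v₂} D]
  {E : Type u₃} [Category.{v₃} E]

theorem exists_adjunction_unit_eq {F : C ⥤ D} {G : D ⥤ C} (η : 𝟭 C ⟶ F ⋙ G)
    (h : ∀ X Y, Function.Bijective fun φ : F.obj X ⟶ Y => η.app X ≫ G.map φ) :
    ∃ adj : F ⊣ G, adj.unit = η := by
  let e X Y := Equiv.ofBijective _ (h X Y)
  have he {X Y} (φ : F.obj X ⟶ Y) : e X Y φ = η.app X ≫ G.map φ := rfl
  refine ⟨Adjunction.mkOfHomEquiv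
    { homEquiv := e
      homEquiv_naturality_left_symm {X X' Y} f g := ?_
      homEquiv_naturality_right φ ψ := ?_ }, ?_⟩
  · have hη := η.naturality_assoc f (G.map ((e X' Y).symm g))
    rw [Equiv.symm_apply_eq, he, G.map_comp]
    rw [← he, Equiv.apply_symm_apply] at hη
    exact hη
  · rw [he, he, G.map_comp, Category.assoc]
  · ext X
    simp [e]

section

variable {F : C ⥤ D} {U : D ⥤ C} (adj : F ⊣ U) {K : D ⥤ E} {G : E ⥤ C} (e : K ⋙ G ≅ U)

theorem counit_app_obj_of_unit_eq {adj' : F ⋙ K ⊣ G}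
    (hunit : ∀ X, adj'.unit.app X = adj.unit.app X ≫ e.inv.app (F.obj X)) (A : D) :
    adj'.counit.app (K.obj A) = K.map ((adj.homEquiv _ A).symm (e.hom.app A)) := by
  apply (adj'.homEquiv _ _).injective
  set ψ := (adj.homEquiv _ A).symm (e.hom.app A)
  have hψ : adj.unit.app _ ≫ U.map ψ = e.hom.app A :=
    (adj.homEquiv_unit ..).symm.trans ((adj.homEquiv _ A).apply_symm_apply _)
  calc adj'.homEquiv _ _ (adj'.counit.app (K.obj A))
      = e.hom.app A ≫ e.inv.app A := by simp [adj'.homEquiv_unit]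
    _ = adj.unit.app _ ≫ U.map ψ ≫ e.inv.app A := by rw [← hψ, Category.assoc]
    _ = adj.unit.app _ ≫ e.inv.app _ ≫ G.map (K.map ψ) := congrArg _ (e.inv.naturality ψ)
    _ = adj'.homEquiv _ _ (K.map ψ) := by
      rw [adj'.homEquiv_unit, hunit, Category.assoc]

theorem exists_adjunction_toMonad_iso
    (h : ∀ X Y, Function.Bijective fun φ : K.obj (F.obj X) ⟶ Y =>
      adj.unit.app X ≫ e.inv.app (F.obj X) ≫ G.map φ) :
    ∃ adj' : F ⋙ K ⊣ G, Nonempty (adj'.toMonad ≅ adj.toMonad) := by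
  obtain ⟨adj', hη⟩ := exists_adjunction_unit_eq
    (adj.unit ≫ Functor.whiskerLeft F e.inv : 𝟭 C ⟶ (F ⋙ K) ⋙ G) fun X Y => by
      simpa using h X Y
  have hunit (X : C) : adj'.unit.app X = adj.unit.app X ≫ e.inv.app (F.obj X) := by simp [hη]
  refine ⟨adj', ⟨MonadIso.mk (Functor.isoWhiskerLeft F e) (fun X => ?_) fun X => ?_⟩⟩
  · calc adj'.unit.app X ≫ e.hom.app (F.obj X)
        = adj.unit.app X ≫ e.inv.app (F.obj X) ≫ e.hom.app (F.obj X) := by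
          rw [hunit, Category.assoc]
      _ = adj.unit.app X := by simp
  · have hψ := adj.homEquiv_counit (g := e.hom.app (F.obj X))
    set ψ := (adj.homEquiv _ (F.obj X)).symm (e.hom.app (F.obj X))
    calc G.map (adj'.counit.app (K.obj (F.obj X))) ≫ e.hom.app (F.obj X)
        = e.hom.app _ ≫ U.map ψ := by
          rw [counit_app_obj_of_unit_eq adj e hunit]
          exact e.hom.naturality ψ
      _ = e.hom.app _ ≫ U.map (F.map (e.hom.app (F.obj X))) ≫ U.map (adj.counit.app _) := by
        rw [hψ, U.map_comp]
      _ = (G.map (K.map (F.map (e.hom.app (F.obj X)))) ≫ e.hom.app _) ≫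
          U.map (adj.counit.app _) :=
        (e.hom.naturality_assoc _ _).symm.trans (Category.assoc _ _ _).symm

end

end AdjunctionMonads

/-! ### The theory of a monad -/

/-- A set of natural numbers as a discrete extended metric space: distinct points are at distance
`∞`. The points serve as variables of preterms. -/
def Disc (S : Set ℕ) : Type := S

namespace Disc

variable {S : Set ℕ}

instance : Countable (Disc S) := inferInstanceAs (Countable S)

open Classical in
noncomputable instance : EMetricSpace (Disc S) where
  edist i j := if i = j then 0 else ⊤
  edist_self i := if_pos rfl
  edist_comm i j := by simp only [eq_comm]
  edist_triangle i j k := by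
    by_cases hij : i = j <;> simp [hij]
  eq_of_edist_eq_zero {i j} h := by
    by_contra hij
    exact ENNReal.top_ne_zero ((if_neg hij).symm.trans h)

theorem edist_eq_top (i j : Disc S) (hij : i ≠ j) : edist i j = ⊤ := if_neg hij

/-- A point of `Disc S` as a variable. -/
def var : Disc S → ℕ := Subtype.val

theorem var_injective : Function.Injective (var (S := S)) := Subtype.val_injective

/-- The discrete space on `S` as an object of `Met`, in an arbitrary universe. -/
noncomputable abbrev toMet (S : Set ℕ) : Met.{u} := Met.of (ULift.{u} (Disc S))

/-- A family of points indexed by `Disc S` as a morphism of `Met`. -/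
noncomputable def hom {X : Met.{u}} (p : NonexpMap (Disc S) X) : toMet.{u} S ⟶ X :=
  ConcreteCategory.ofHom ⟨fun i => p i.down, fun i j => p.nonexp i.down j.down⟩

theorem hom_comp {X Y : Met.{u}} (p : NonexpMap (Disc S) X) (f : X ⟶ Y) :
    hom p ≫ f = hom ((ConcreteCategory.hom f).comp p) := rfl

theorem hom_surjective {X : Met.{u}} {p : NonexpMap (Disc S) X} (hp : Function.Surjective p) :
    Function.Surjective (hom p) :=
  hp.comp ULift.down_surjective

theorem exists_surjective (X : Type v) [EMetricSpace X] [Countable X] :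
    ∃ (S : Set ℕ) (p : NonexpMap (Disc S) X), Function.Surjective p := by
  obtain ⟨e, he⟩ := exists_injective_nat X
  exact ⟨Set.range e, .ofDiscrete edist_eq_top (Equiv.ofInjective e he).symm,
    (Equiv.ofInjective e he).symm.surjective⟩

end Disc

namespace MonadTheory

variable (T : Monad Met.{u})

/-- The signature whose operations of arity `S` are the elements of `T S`, for discrete countable
spaces `S`. -/
noncomputable abbrev signature : MetricSignature.{u} where
  Op := Σ S : Set ℕ, T.obj (Disc.toMet S)
  Arity f := Disc f.1

theorem signature_isDiscrete : (signature T).IsDiscrete := fun _ => Disc.edist_eq_top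

variable {T} (hE : IsMetEnriched T.toFunctor)

/-- A `T`-algebra as a model of the signature of `T`. -/
noncomputable abbrev algebraModel (A : T.Algebra) : SigModel (signature T) where
  space := A.A
  op f :=
    { toFun a := A.a (T.map (Disc.hom a) f.2)
      nonexp' a b := calc
        edist (A.a (T.map (Disc.hom a) f.2)) (A.a (T.map (Disc.hom b) f.2))
          ≤ edist (T.map (Disc.hom a) f.2) (T.map (Disc.hom b) f.2) := A.a.nonexp _ _
        _ ≤ edist (ConcreteCategory.hom (Disc.hom a)) (ConcreteCategory.hom (Disc.hom b)) :=
          NonexpMap.edist_le_iff.1 (hE _ _ _ _) f.2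
        _ ≤ edist a b := NonexpMap.edist_le_iff.2 fun i => NonexpMap.edist_apply_le a b i.down }

/-- A `T`-algebra morphism as a homomorphism of models. -/
noncomputable def algebraModelMap {A B : T.Algebra} (φ : A ⟶ B) :
    algebraModel hE A ⟶ algebraModel hE B where
  map := φ.f
  map_op f a := by
    have h : (T.map (Disc.hom a) ≫ A.a) ≫ φ.f =
        T.map (Disc.hom ((ConcreteCategory.hom φ.f).comp a)) ≫ B.a := by
      rw [← Disc.hom_comp, T.map_comp, Category.assoc, Category.assoc, φ.h]
    exact ConcreteCategory.congr_hom h f.2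

/-- The theory of `T`: all judgments valid in every `T`-algebra. -/
noncomputable def theory : MetricTheory (signature T) :=
  .ofModels (signature_isDiscrete T) (algebraModel hE)

/-- The comparison functor, regarding `T`-algebras as models of the theory of `T`. -/
noncomputable def comparison : T.Algebra ⥤ (theory hE).Mod where
  obj A := ⟨algebraModel hE A, MetricTheory.isModel_ofModels _ _ A⟩
  map φ := ObjectProperty.homMk (algebraModelMap hE φ)

/-- The free `T`-algebra on a space, as a model of the signature of `T`. -/
noncomputable abbrev freeModel (X : Met.{u}) : SigModel (signature T) :=
  algebraModel hE (T.free.obj X)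

/-- The homomorphism from the free algebra on `X` that extends a map from `X` to an algebra. -/
noncomputable def extend {X : Met.{u}} {A : T.Algebra} (q : X ⟶ A.A) :
    freeModel hE X ⟶ algebraModel hE A :=
  algebraModelMap hE ((T.adj.homEquiv X A).symm q)

theorem extend_unit {X : Met.{u}} {A : T.Algebra} (q : X ⟶ A.A) (x : X) :
    (extend hE q).map (T.η.app X x) = q x :=
  ConcreteCategory.congr_hom ((T.adj.homEquiv X A).apply_symm_apply q) x

theorem map_hom_eq_op {X : Met.{u}} {S : Set ℕ} (z : T.obj (Disc.toMet S))
    (p : NonexpMap (Disc S) X) : T.map (Disc.hom p) z =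
      (freeModel hE X).op ⟨S, z⟩ ((ConcreteCategory.hom (T.η.app X)).comp p) := by
  have h : T.map (Disc.hom p) =
      T.map (Disc.hom ((ConcreteCategory.hom (T.η.app X)).comp p)) ≫ T.μ.app X := by
    rw [← Disc.hom_comp, T.map_comp, Category.assoc, T.right_unit, Category.comp_id]
  exact ConcreteCategory.congr_hom h z

/-- The preterm `t`, its variables standing for the points `p i` of `X`, denotes the element `z` of
the free algebra on `X`: for every map `q` from `X` to an algebra, the value of `t` in the algebra
is the value at `z` of the extension of `q`. -/
def Denotes {X : Met.{u}} {S : Set ℕ} (p : NonexpMap (Disc S) X) (t : Preterm (signature T))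
    (z : T.obj X) : Prop :=
  ∀ (A : T.Algebra) (q : X ⟶ A.A),
    (algebraModel hE A).EvalOn Disc.var (fun i => q (p i)) t ((extend hE q).map z)

/-- Some preterm denoting `z` has value `m` in `M` when the variables are interpreted by `f`, so
that `m` is the only possible value at `z` of a homomorphism from the free algebra on `X` to `M`
that extends `f`. -/
def IsValue {X : Met.{u}} {S : Set ℕ} (p : NonexpMap (Disc S) X) {M : SigModel (signature T)}
    (f : X ⟶ M.space) (z : T.obj X) (m : M.space) : Prop :=
  ∃ t, Denotes hE p t z ∧ M.EvalOn Disc.var (fun i => f (p i)) t m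

variable {hE} {X : Met.{u}} {S : Set ℕ} {p : NonexpMap (Disc S) X} {M : SigModel (signature T)}

namespace Denotes

theorem var (i : Disc S) : Denotes hE p (.var i.var) (T.η.app X (p i)) := by
  intro A q
  rw [extend_unit]
  exact .var i

theorem app {f : (signature T).Op} {t : (signature T).Arity f → Preterm (signature T)}
    {b : NonexpMap ((signature T).Arity f) (freeModel hE X).space}
    (h : ∀ i, Denotes hE p (t i) (b i)) :
    Denotes hE p (.app f t) ((freeModel hE X).op f b) := by
  intro A q
  rw [(extend hE q).map_op f b]
  exact .app fun i => h i A q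

theorem sat_eq (hp : Function.Surjective p) {s t : Preterm (signature T)} {z w : T.obj X}
    (hs : Denotes hE p s z) (ht : Denotes hE p t w) {ε : ℝ≥0} (hzw : edist z w ≤ ε)
    (A : T.Algebra) : (algebraModel hE A).Sat (.ofPoints Disc.var p) (.eq s t ε) := by
  intro α hα
  obtain ⟨q, hq⟩ := (SigModel.satCtx_ofPoints_iff_exists_nonexpMap hp).1 hα
  exact ⟨_, _, hs A q α hq, ht A q α hq, ((extend hE q).map.nonexp z w).trans hzw⟩

end Denotes

namespace IsValue

variable {f : X ⟶ M.space}

theorem unit (i : Disc S) : IsValue hE p f (T.η.app X (p i)) (f (p i)) :=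
  ⟨.var i.var, .var i, .var i⟩

theorem op {g : (signature T).Op}
    {b : NonexpMap ((signature T).Arity g) (freeModel hE X).space}
    {c : NonexpMap ((signature T).Arity g) M.space} (h : ∀ i, IsValue hE p f (b i) (c i)) :
    IsValue hE p f ((freeModel hE X).op g b) (M.op g c) := by
  choose t hb hc using h
  exact ⟨.app g t, .app hb, .app hc⟩

theorem map_hom (z : T.obj (Disc.toMet S)) : IsValue hE p f (T.map (Disc.hom p) z)
    (M.op ⟨S, z⟩ ((ConcreteCategory.hom f).comp p)) := by
  rw [map_hom_eq_op hE]
  exact op unit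

theorem edist_le (hp : Function.Surjective p) (hM : (theory hE).isModel M) {z w : T.obj X}
    {m n : M.space} (hm : IsValue hE p f z m) (hn : IsValue hE p f w n) :
    edist m n ≤ edist z w := by
  rcases eq_or_ne (edist z w) ⊤ with hzw | hzw
  · exact le_top.trans_eq hzw.symm
  obtain ⟨s, hs, hsm⟩ := hm
  obtain ⟨t, ht, htn⟩ := hn
  let α : ℕ → M.space := Function.extend Disc.var (fun i => f (p i)) fun _ => m
  have hα (i : Disc S) : α i.var = f (p i) := Disc.var_injective.extend_apply _ _ i
  have hΓ : M.SatCtx α (.ofPoints Disc.var p) :=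
    (SigModel.satCtx_ofPoints_iff_exists_nonexpMap hp).2 ⟨f, hα⟩
  have hst : M.Sat (.ofPoints Disc.var p) (.eq s t (edist z w).toNNReal) :=
    hM ⟨_, _⟩ (hs.sat_eq hp ht (ENNReal.coe_toNNReal hzw).ge)
  obtain ⟨m', n', hm', hn', h⟩ := hst α hΓ
  rwa [(hsm α hα).unique hm', (htn α hα).unique hn', ← ENNReal.coe_toNNReal hzw]

end IsValue

theorem exists_extension_of_countable (hT : PreservesSurjections T.toFunctor) (X : Met.{u})
    [Countable X] (hM : (theory hE).isModel M) (f : X ⟶ M.space) :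
    ∃ h : freeModel hE X ⟶ M, T.η.app X ≫ h.map = f := by
  obtain ⟨S, p, hp⟩ := Disc.exists_surjective X
  have htotal (z : T.obj X) : ∃ m, IsValue hE p f z m := by
    obtain ⟨z₀, rfl⟩ := hT _ _ _ (Disc.hom_surjective hp) z
    exact ⟨_, .map_hom z₀⟩
  choose h hh using htotal
  have h_eq {z : T.obj X} {m : M.space} (hm : IsValue hE p f z m) : h z = m :=
    edist_le_zero.1 (((hh z).edist_le hp hM hm).trans_eq (edist_self z))
  refine ⟨⟨ConcreteCategory.ofHom ⟨h, fun z w => (hh z).edist_le hp hM (hh w)⟩,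
    fun g a => h_eq (.op fun i => hh (a i))⟩, ConcreteCategory.hom_ext _ _ fun x => ?_⟩
  obtain ⟨i, rfl⟩ := hp x
  exact h_eq (.unit i)

theorem exists_map_hom_eq (hA : HasCountableArity T.toFunctor)
    (hT : PreservesSurjections T.toFunctor) (z : T.obj X) :
    ∃ (S : Set ℕ) (z₀ : T.obj (Disc.toMet S)) (p : NonexpMap (Disc S) X),
      T.map (Disc.hom p) z₀ = z := by
  obtain ⟨B, b, hb⟩ := hA.exists_countable_lift fun _ : Unit => z
  have : Countable (Met.of B.1) := B.2
  obtain ⟨S, p, hp⟩ := Disc.exists_surjective (Met.of B.1)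
  obtain ⟨z₀, hz₀⟩ := hT _ _ _ (Disc.hom_surjective hp) (b ())
  refine ⟨S, z₀, (ConcreteCategory.hom (Met.incl B.1)).comp p, ?_⟩
  rw [← Disc.hom_comp, T.map_comp, ← hb (), ← hz₀]
  rfl

theorem freeModel_hom_ext (hA : HasCountableArity T.toFunctor)
    (hT : PreservesSurjections T.toFunctor) {h k : freeModel hE X ⟶ M}
    (hhk : T.η.app X ≫ h.map = T.η.app X ≫ k.map) : h = k := by
  refine SigModel.Hom.ext (ConcreteCategory.hom_ext _ _ fun z => ?_)
  obtain ⟨S, z₀, p, rfl⟩ := exists_map_hom_eq hA hT z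
  rw [map_hom_eq_op hE]
  refine (h.map_op _ _).trans (Eq.trans ?_ (k.map_op _ _).symm)
  exact congrArg (M.op ⟨S, z₀⟩) (NonexpMap.ext fun i => ConcreteCategory.congr_hom hhk (p i))

theorem map_op_of_forall_countable (hA : HasCountableArity T.toFunctor) {h : T.obj X ⟶ M.space}
    (hB : ∀ B : Met.CountableSubsets X, ∃ k : freeModel hE (Met.of B.1) ⟶ M,
      T.map (Met.incl B.1) ≫ h = k.map)
    (g : (signature T).Op) (a : NonexpMap ((signature T).Arity g) (freeModel hE X).space) :
    h ((freeModel hE X).op g a) = M.op g ((ConcreteCategory.hom h).comp a) := by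
  obtain ⟨B, b, hb⟩ := hA.exists_countable_lift a
  let b' : NonexpMap ((signature T).Arity g) (freeModel hE (Met.of B.1)).space :=
    .ofDiscrete (signature_isDiscrete T g) b
  let ι := algebraModelMap hE (T.free.map (Met.incl B.1))
  obtain rfl : (ConcreteCategory.hom ι.map).comp b' = a := NonexpMap.ext hb
  obtain ⟨k, hk⟩ := hB B
  calc h ((freeModel hE X).op g ((ConcreteCategory.hom ι.map).comp b'))
      = h (ι.map ((freeModel hE _).op g b')) := congrArg h (ι.map_op g b').symm
    _ = k.map ((freeModel hE _).op g b') := ConcreteCategory.congr_hom hk _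
    _ = M.op g ((ConcreteCategory.hom k.map).comp b') := k.map_op g b'
    _ = M.op g ((ConcreteCategory.hom h).comp ((ConcreteCategory.hom ι.map).comp b')) := by
      rw [← hk]
      rfl

theorem exists_extension (hA : HasCountableArity T.toFunctor)
    (hT : PreservesSurjections T.toFunctor) (hM : (theory hE).isModel M) (f : X ⟶ M.space) :
    ∃ h : freeModel hE X ⟶ M, T.η.app X ≫ h.map = f := by
  have hex (B : Met.CountableSubsets X) : ∃ h : freeModel hE (Met.of B.1) ⟶ M,
      T.η.app (Met.of B.1) ≫ h.map = Met.incl B.1 ≫ f :=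
    have : Countable (Met.of B.1) := B.2
    exists_extension_of_countable hT _ hM _
  choose h hh using hex
  have hcompat {A B : Met.CountableSubsets X} (l : A ⟶ B) :
      algebraModelMap hE (T.free.map ((Met.CountableSubsets.diagram X).map l)) ≫ h B = h A :=
    freeModel_hom_ext hA hT <| by
      let d := (Met.CountableSubsets.diagram X).map l
      calc T.η.app _ ≫ T.map d ≫ (h B).map
          = d ≫ T.η.app _ ≫ (h B).map := (T.η.naturality_assoc d _).symm
        _ = d ≫ Met.incl B.1 ≫ f := congrArg (d ≫ ·) (hh B)
        _ = T.η.app _ ≫ (h A).map := (hh A).symm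
  obtain ⟨hc⟩ := hA.nonempty_isColimit_mapCocone X
  let c : Cocone (Met.CountableSubsets.diagram X ⋙ T.toFunctor) :=
    { pt := M.space
      ι :=
        { app B := (h B).map
          naturality _ _ l := congrArg SigModel.Hom.map (hcompat l) } }
  have hfac (B : Met.CountableSubsets X) : T.map (Met.incl B.1) ≫ hc.desc c = (h B).map :=
    hc.fac c B
  refine ⟨⟨hc.desc c, map_op_of_forall_countable hA fun B => ⟨h B, hfac B⟩⟩,
    (Met.CountableSubsets.isColimitCocone X).hom_ext fun B => ?_⟩
  calc Met.incl B.1 ≫ T.η.app X ≫ hc.desc c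
      = T.η.app _ ≫ T.map (Met.incl B.1) ≫ hc.desc c := T.η.naturality_assoc _ _
    _ = Met.incl B.1 ≫ f := by rw [hfac, hh]

theorem theory_axiomatizes (hA : HasCountableArity T.toFunctor)
    (hT : PreservesSurjections T.toFunctor) : (theory hE).Axiomatizes T := by
  let e : comparison hE ⋙ (theory hE).forget ≅ T.forget := Iso.refl _
  have hfree (X : Met.{u}) (M : (theory hE).Mod) : Function.Bijective fun
      φ : (comparison hE).obj (T.free.obj X) ⟶ M =>
        T.adj.unit.app X ≫ e.inv.app (T.free.obj X) ≫ (theory hE).forget.map φ := by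
    refine ⟨fun φ ψ hφψ => ObjectProperty.hom_ext _ ?_, fun f => ?_⟩
    · exact freeModel_hom_ext (hE := hE) hA hT hφψ
    · obtain ⟨h, hh⟩ := exists_extension hA hT M.property f
      exact ⟨ObjectProperty.homMk h, hh⟩
  obtain ⟨adj, ⟨i⟩⟩ := exists_adjunction_toMonad_iso T.adj e hfree
  exact ⟨T.free ⋙ comparison hE, adj, ⟨i ≪≫ Adjunction.adjToMonadIso T⟩⟩

end MonadTheory

theorem isQETAxiomatizable_of_preservesSurjections {T : Monad Met.{u}}
    (hE : IsMetEnriched T.toFunctor) (hA : HasCountableArity T.toFunctor)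
    (hT : PreservesSurjections T.toFunctor) : IsQETAxiomatizable T :=
  ⟨MonadTheory.signature T, MonadTheory.signature_isDiscrete T, MonadTheory.theory hE,
    MonadTheory.theory_axiomatizes hA hT⟩

theorem mainTheorem3 (T : Monad Met.{u}) (hEnriched : IsMetEnriched T.toFunctor)
    (hArity : HasCountableArity T.toFunctor) :
    IsQETAxiomatizable T ↔ PreservesSurjections T.toFunctor :=
  ⟨IsQETAxiomatizable.preservesSurjections,
    isQETAxiomatizable_of_preservesSurjections hEnriched hArity⟩
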